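/- Theorem (Marstrand, Tricot). Let $m,n\ge 0$ and let $E\subseteq\mathbb{R}^m$ and $F\subseteq\mathbb{R}^n$ be arbitrary nonempty sets. Then $$\dim_H(E)+\dim_H(F)\;\le\;\dim_H(E\times F)\;\le\;\dim_H(E)+\dim_P(F)\;\le\;\dim_P(E\times F)\;\le\;\dim_P(E)+\dim_P(F),$$ where $E\times F\subseteq\mathbb{R}^{m+n}$, $\dim_H$ is Hausdorff dimension and $\dim_P$ is packing dimension, all with respect to Euclidean distances. Here packing dimension is defined as follows. For $A\subseteq\mathbb{R}^k$, $s\ge 0$ and $\delta>0$, let $P^s_\delta(A)$ be the supremum of $\sum_i \operatorname{diam}(V_i)^s$ over all countable families $\{V_i\}$ of pairwise disjoint open balls with centres in $A$ and radii at most $\delta/2$; let $P^s_0(A)=\lim_{\delta\to 0^+}P^s_\delta(A)$ and $P^s(A)=\inf\{\sum_{i\in\mathbb{N}}P^s_0(A_i) : A\subseteq\bigcup_{i\in\mathbb{N}}A_i\}$. Then $\dim_P(A)=\inf\{s\ge 0:P^s(A)=0\}=\sup\{s>0:P^s(A)=\infty\}$, with $\sup\emptyset=0$. -/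

import Mathlib

open Set Filter Topology
open scoped NNReal ENNReal

noncomputable section

/-- The balls `B_{ρ i}(x i)` form a countable packing of `E` by open balls of diameter at most `δ`:
the centres are in `E`, the radii are in `[0, δ/2]`, and the balls are pairwise disjoint.
Balls of radius `0` are empty, so that finite packings are included. -/
structure IsBallPacking {X : Type*} [MetricSpace X] (E : Set X) (δ : ℝ) (x : ℕ → X) (ρ : ℕ → ℝ) :
    Prop where
  center_mem : ∀ i, x i ∈ E
  radius_mem : ∀ i, ρ i ∈ Icc 0 (δ / 2)
  disjoint : ∀ i j, i ≠ j → Disjoint (Metric.ball (x i) (ρ i)) (Metric.ball (x j) (ρ j))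

/-- `P_δ^s(E)`: the supremum of `∑ diam(V_i)^s` over the packings `{V_i}` of `E` by open balls of
diameter at most `δ`. As in Mathlib's Hausdorff measure, empty sets contribute `0`
(this matters only for `s = 0`). -/
def packingPreDelta {X : Type*} [MetricSpace X] (s : ℝ≥0) (δ : ℝ) (E : Set X) : ℝ≥0∞ :=
  ⨆ (x : ℕ → X) (ρ : ℕ → ℝ) (_ : IsBallPacking E δ x ρ),
    ∑' i, ⨆ _ : (Metric.ball (x i) (ρ i)).Nonempty, Metric.ediam (Metric.ball (x i) (ρ i)) ^ (s : ℝ)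

/-- `P_0^s(E)`, the limit of `P_δ^s(E)` as `δ → 0+`; since `P_δ^s(E)` is monotone in `δ`, the limit
is an infimum (see `tendsto_packingPreDelta`). -/
def packingPre {X : Type*} [MetricSpace X] (s : ℝ≥0) (E : Set X) : ℝ≥0∞ :=
  ⨅ (δ : ℝ) (_ : 0 < δ), packingPreDelta s δ E

/-- The `s`-dimensional packing (outer) measure `P^s(E)`. -/
def packingMeasure {X : Type*} [MetricSpace X] (s : ℝ≥0) (E : Set X) : ℝ≥0∞ :=
  ⨅ (T : ℕ → Set X) (_ : E ⊆ ⋃ i, T i), ∑' i, packingPre s (T i)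

/-- The packing dimension `dim_P(E) = sup {s > 0 : P^s(E) = ∞}`, with `sup ∅ = 0`
(it is also `inf {s : P^s(E) = 0}`, see `dimP_eq_iInf`). -/
def dimP {X : Type*} [MetricSpace X] (E : Set X) : ℝ≥0∞ :=
  ⨆ (s : ℝ≥0) (_ : 0 < s) (_ : packingMeasure s E = ∞), (s : ℝ≥0∞)

/-- The Cartesian product of `E ⊆ ℝᵐ` and `F ⊆ ℝⁿ` as a subset of the Euclidean space `ℝᵐ⁺ⁿ`:
the points whose first `m` coordinates form a point of `E` and last `n` a point of `F`. -/
def euclideanProd {m n : ℕ} (E : Set (EuclideanSpace ℝ (Fin m)))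
    (F : Set (EuclideanSpace ℝ (Fin n))) : Set (EuclideanSpace ℝ (Fin (m + n))) :=
  {z | WithLp.toLp 2 (fun i : Fin m => z (Fin.castAdd n i)) ∈ E ∧
       WithLp.toLp 2 (fun j : Fin n => z (Fin.natAdd m j)) ∈ F}

theorem packingPreDelta_mono {X : Type*} [MetricSpace X] (s : ℝ≥0) (E : Set X) {δ ε : ℝ}
    (h : δ ≤ ε) : packingPreDelta s δ E ≤ packingPreDelta s ε E := by
  refine iSup_mono fun x => iSup_mono fun ρ => iSup_mono' fun hp => ⟨⟨hp.1, fun i => ?_, hp.3⟩, le_rfl⟩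
  have := hp.2 i
  exact ⟨this.1, by linarith [this.2]⟩

theorem tendsto_packingPreDelta {X : Type*} [MetricSpace X] (s : ℝ≥0) (E : Set X) :
    Tendsto (fun δ => packingPreDelta s δ E) (𝓝[>] 0) (𝓝 (packingPre s E)) := by
  have h : Monotone fun δ : ℝ => packingPreDelta s δ E := fun _ _ h => packingPreDelta_mono s E h
  have := h.tendsto_nhdsGT 0
  rwa [sInf_image] at this

theorem packingPreDelta_le {X : Type*} [MetricSpace X] {s t : ℝ≥0} (h : s < t) (E : Set X) (δ : ℝ) :
    packingPreDelta t δ E ≤ ENNReal.ofReal δ ^ ((t : ℝ) - s) * packingPreDelta s δ E := by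
  have hst : (0 : ℝ) < t - s := sub_pos.2 (by exact_mod_cast h)
  refine iSup_le fun x => iSup_le fun ρ => iSup_le fun hp => ?_
  have key : _ ≤ packingPreDelta s δ E :=
    le_iSup_of_le x (le_iSup_of_le ρ (le_iSup_of_le hp le_rfl))
  refine le_trans ?_ (mul_le_mul' le_rfl key)
  rw [← ENNReal.tsum_mul_left]
  refine ENNReal.tsum_le_tsum fun i => iSup_le fun hne => ?_
  refine le_trans ?_ (mul_le_mul' le_rfl (le_iSup_of_le hne le_rfl))
  have hd : Metric.ediam (Metric.ball (x i) (ρ i)) ≤ ENNReal.ofReal δ := by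
    refine Metric.ediam_le fun a ha b hb => ?_
    rw [edist_dist]
    refine ENNReal.ofReal_le_ofReal ?_
    have h1 := Metric.mem_ball.1 ha
    have h2 := Metric.mem_ball'.1 hb
    linarith [dist_triangle a (x i) b, (hp.2 i).2]
  calc Metric.ediam (Metric.ball (x i) (ρ i)) ^ (t : ℝ)
      = Metric.ediam (Metric.ball (x i) (ρ i)) ^ (((t : ℝ) - s) + s) := by ring_nf
    _ = Metric.ediam (Metric.ball (x i) (ρ i)) ^ ((t : ℝ) - s)
        * Metric.ediam (Metric.ball (x i) (ρ i)) ^ (s : ℝ) :=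
        ENNReal.rpow_add_of_nonneg _ _ hst.le s.2
    _ ≤ _ := by gcongr

theorem packingPre_eq_zero {X : Type*} [MetricSpace X] {s t : ℝ≥0} (h : s < t) {E : Set X}
    (hE : packingPre s E ≠ ∞) : packingPre t E = 0 := by
  have hst : (0 : ℝ) < t - s := sub_pos.2 (by exact_mod_cast h)
  have h0 : Tendsto (fun δ : ℝ => ENNReal.ofReal δ ^ ((t : ℝ) - s)) (𝓝[>] 0) (𝓝 0) := by
    have h1 : Tendsto (fun δ : ℝ => ENNReal.ofReal δ) (𝓝[>] 0) (𝓝 0) := by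
      simpa using (ENNReal.continuous_ofReal.tendsto 0).mono_left nhdsWithin_le_nhds
    simpa [Function.comp_def, hst] using ((ENNReal.continuous_rpow_const (y := (t : ℝ) - s)).tendsto 0).comp h1
  have h2 := ENNReal.Tendsto.mul h0 (Or.inr hE) (tendsto_packingPreDelta s E) (Or.inr (by simp))
  rw [zero_mul] at h2
  exact le_antisymm (le_of_tendsto_of_tendsto' (tendsto_packingPreDelta t E) h2
    fun δ => packingPreDelta_le h E δ) bot_le

theorem packingMeasure_eq_zero {X : Type*} [MetricSpace X] {s t : ℝ≥0} (h : s < t) {E : Set X}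
    (hE : packingMeasure s E ≠ ∞) : packingMeasure t E = 0 := by
  obtain ⟨T, hT⟩ := iInf_lt_iff.1 (lt_top_iff_ne_top.2 hE)
  obtain ⟨hET, hT⟩ := iInf_lt_iff.1 hT
  refine le_antisymm (iInf₂_le_of_le T hET ?_) bot_le
  simp [fun i => packingPre_eq_zero h (ENNReal.ne_top_of_tsum_ne_top hT.ne i)]

/-- The two usual definitions of the packing dimension agree. -/
theorem dimP_eq_iInf {X : Type*} [MetricSpace X] (E : Set X) :
    dimP E = ⨅ (s : ℝ≥0) (_ : packingMeasure s E = 0), (s : ℝ≥0∞) := by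
  apply le_antisymm
  · refine iSup_le fun s => iSup_le fun _ => iSup_le fun hs => le_iInf fun t => le_iInf fun ht => ?_
    by_contra! hlt
    have := packingMeasure_eq_zero (by exact_mod_cast hlt : t < s) (E := E) (by simp [ht])
    simp [this] at hs
  · refine ENNReal.le_of_forall_pos_le_add fun ε hε hfin => ?_
    lift dimP E to ℝ≥0 using hfin.ne with d hd
    have h1 : packingMeasure (d + ε / 2) E ≠ ∞ := fun h => by
      have : ((d + ε / 2 : ℝ≥0) : ℝ≥0∞) ≤ d := by
        rw [hd]
        exact le_iSup_of_le _ (le_iSup_of_le (by positivity) (le_iSup_of_le h le_rfl))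
      have h3 : d + ε / 2 ≤ d := by exact_mod_cast this
      exact absurd h3 (not_le.2 (lt_add_of_pos_right d (by positivity)))
    have h2 : packingMeasure (d + ε) E = 0 :=
      packingMeasure_eq_zero (add_lt_add_right (NNReal.half_lt_self hε.ne') d) h1
    exact_mod_cast iInf₂_le_of_le (d + ε) h2 le_rfl

end

open MeasureTheory Metric

/-! Packing dimension enters only through box counting. Up to arbitrarily small loss in the
exponent, `dimP A < t` means that `A` is covered by countably many sets whose `r`-packing numbers
are `O(r⁻ᵗ)` (`exists_cover_packingNumberBound_of_dimP_lt`, `dimP_le_of_subset_iUnion`). With this,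
three of the inequalities are counting arguments.

Second inequality: cover `E` by sets of size `r i` with `∑ (r i)^s` small, and multiply each by
`O((r i)⁻ᵗ)` balls of radius `r i` covering a piece of `F` (`hausdorffMeasure_add_eq_zero`). Fourth:
products of covers at one scale (`packingNumberBound_prod`). Third: if pieces `T i` with packing
numbers `O(r⁻ᵘ)` cover the product and `E` has positive `s`-measure, then over each `y ∈ F` some
slice of some `T i` has packing numbers at least a constant times `r⁻ˢ`. Few separated `y` can have
such slices in the same `T i`, so `F` splits into countably many sets with packing numbers
`O(r⁻⁽ᵘ⁻ˢ⁾)` (`packingNumberBound_slices`).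

The first inequality is the delicate one, since `E` and `F` need not be measurable. Given a cover of
the product by sets of size `r i`, the sets lying over a fixed `x ∈ E` cover `F`, so their `(r i)^t`
sum to at least some `b > 0`. The projections to `E` with weights `(r i)^t / b` thus form a
fractional cover of `E`. Rounding it to a genuine cover by dyadic cubes, by means of a random
threshold, costs only a constant factor; hence `∑ (r i)^(s+t)` is bounded below
(`exists_pos_le_tsum_mul_of_hausdorffMeasure_ne_zero`, `hausdorffMeasure_add_ne_zero`). -/

/-! ### Hausdorff measure and sums over covers -/

theorem exists_cover_of_hausdorffMeasure_eq_zero {X : Type*} [MetricSpace X] [MeasurableSpace X]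
    [BorelSpace X] {s : ℝ} (hs : 0 < s) {A : Set X} (h : Measure.hausdorffMeasure s A = 0)
    {ε : ℝ≥0∞} (hε : ε ≠ 0) :
    ∃ (S : ℕ → Set X) (r : ℕ → ℝ≥0), A ⊆ ⋃ i, S i ∧ (∀ i, 0 < r i) ∧ (∀ i, r i ≤ 1) ∧
      (∀ i, ediam (S i) ≤ r i) ∧ ∑' i, (r i : ℝ≥0∞) ^ s ≤ ε := by
  have hε2 : ε / 2 ≠ 0 := (ENNReal.half_pos hε).ne'
  obtain ⟨η, hη, hsum⟩ := ENNReal.exists_pos_sum_of_countable hε2 ℕ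
  have h1 : (⨅ (t : ℕ → Set X) (_ : A ⊆ ⋃ n, t n) (_ : ∀ n, ediam (t n) ≤ 1),
      ∑' n, ⨆ _ : (t n).Nonempty, ediam (t n) ^ s) < ε / 2 := by
    refine lt_of_le_of_lt ?_ (pos_iff_ne_zero.2 hε2)
    rw [← h, Measure.hausdorffMeasure_apply]
    exact le_iSup₂_of_le 1 one_pos le_rfl
  simp only [iInf_lt_iff] at h1
  obtain ⟨S, hAS, hS1, hS⟩ := h1
  have hfin i : ediam (S i) ≠ ∞ := ((hS1 i).trans_lt ENNReal.one_lt_top).ne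
  -- Diameters may vanish, but a scale has to be positive; the enlargement adds at most the summable
  -- `η i` to the sum.
  refine ⟨S, fun i => max (ediam (S i)).toNNReal (min 1 (η i ^ s⁻¹)), hAS, fun i => ?_, fun i => ?_,
    fun i => ?_, ?_⟩
  · exact lt_max_of_lt_right (lt_min one_pos (NNReal.rpow_pos (hη i)))
  · refine max_le ?_ (min_le_left _ _)
    simpa using ENNReal.toNNReal_mono ENNReal.one_ne_top (hS1 i)
  · rw [ENNReal.coe_max, ENNReal.coe_toNNReal (hfin i)]
    exact le_max_left _ _
  · calc _ ≤ ∑' i, ((⨆ _ : (S i).Nonempty, ediam (S i) ^ s) + η i) := by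
          refine ENNReal.tsum_le_tsum fun i => ?_
          rw [ENNReal.coe_max, ENNReal.coe_toNNReal (hfin i)]
          rcases max_choice (ediam (S i)) ((min 1 (η i ^ s⁻¹) : ℝ≥0) : ℝ≥0∞) with hm | hm <;> rw [hm]
          · refine le_add_right ?_
            rcases (S i).eq_empty_or_nonempty with he | hne
            · simp [he, hs]
            · exact le_iSup_of_le hne le_rfl
          · refine le_add_left ?_
            rw [← ENNReal.coe_rpow_of_nonneg _ hs.le, ENNReal.coe_le_coe]
            calc _ ≤ (η i ^ s⁻¹) ^ s := by gcongr; exact min_le_right _ _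
              _ = η i := NNReal.rpow_inv_rpow hs.ne' _
      _ ≤ ε / 2 + ε / 2 := by
          rw [ENNReal.tsum_add]
          exact add_le_add hS.le hsum.le
      _ = ε := ENNReal.add_halves ε

/-- Positive measure forces positive Hausdorff content, with no smallness condition on the cover:
for `s > 0` a cover with a small sum consists of small sets anyway, so covers with sums tending to
zero would make the measure zero. -/
theorem exists_pos_le_tsum_of_hausdorffMeasure_ne_zero.{u, v} {X : Type u} [MetricSpace X]
    [MeasurableSpace X] [BorelSpace X] {s : ℝ} (hs : 0 ≤ s) {A : Set X}
    (h : Measure.hausdorffMeasure s A ≠ 0) :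
    ∃ c : ℝ≥0, 0 < c ∧ ∀ (ι : Type v) [Countable ι] (S : ι → Set X) (r : ι → ℝ≥0),
      (∀ i, ediam (S i) ≤ r i) → A ⊆ ⋃ i, S i → (c : ℝ≥0∞) ≤ ∑' i, (r i : ℝ≥0∞) ^ s := by
  rcases hs.eq_or_lt with rfl | hs
  · refine ⟨1, one_pos, fun ι _ S r _ hA => ?_⟩
    obtain ⟨x, hx⟩ : A.Nonempty := by
      by_contra hne
      rw [not_nonempty_iff_eq_empty] at hne
      simp [hne] at h
    obtain ⟨i, -⟩ := mem_iUnion.1 (hA hx)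
    simpa using ENNReal.le_tsum (f := fun i => (r i : ℝ≥0∞) ^ (0 : ℝ)) i
  · by_contra! hcon
    choose ι hι S r hr hA hlt using fun n : ℕ => hcon ((n : ℝ≥0) + 1)⁻¹ (by positivity)
    have h0 : Tendsto (fun n : ℕ => (((n : ℝ≥0) + 1)⁻¹ : ℝ≥0)) atTop (𝓝 0) := by
      simpa [one_div] using tendsto_one_div_add_atTop_nhds_zero_nat (𝕜 := ℝ≥0)
    have h0' : Tendsto (fun n : ℕ => (((((n : ℝ≥0) + 1)⁻¹ : ℝ≥0)) : ℝ≥0∞)) atTop (𝓝 0) :=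
      ENNReal.tendsto_coe.2 h0
    have h1 : Tendsto (fun n : ℕ => (((((n : ℝ≥0) + 1)⁻¹ : ℝ≥0)) : ℝ≥0∞) ^ s⁻¹) atTop (𝓝 0) := by
      have := ((ENNReal.continuous_rpow_const (y := s⁻¹)).tendsto 0).comp h0'
      simpa [Function.comp_def, ENNReal.zero_rpow_of_pos (inv_pos.2 hs)] using this
    have key := Measure.hausdorffMeasure_le_liminf_tsum s A
      (fun n : ℕ => (((((n : ℝ≥0) + 1)⁻¹ : ℝ≥0)) : ℝ≥0∞) ^ s⁻¹) h1 S
      (Eventually.of_forall fun n i => ?_) (Eventually.of_forall hA)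
    · refine h (le_antisymm (key.trans ?_) bot_le)
      refine (liminf_le_liminf (Eventually.of_forall fun n => ?_)).trans h0'.liminf_eq.le
      refine le_trans (ENNReal.tsum_le_tsum fun i => ?_) (hlt n).le
      exact ENNReal.rpow_le_rpow (hr n i) hs.le
    · rw [ENNReal.le_rpow_inv_iff hs]
      refine le_trans ?_ (hlt n).le
      exact (ENNReal.rpow_le_rpow (hr n i) hs.le).trans
        (ENNReal.le_tsum (f := fun i => (r n i : ℝ≥0∞) ^ s) i)

/-! ### Rounding fractional covers on a tree -/

theorem volume_ofReal_mem_Ico_le (S v : ℝ≥0∞) :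
    (volume.restrict (Ico (0 : ℝ) 1)) {θ | S ≤ ENNReal.ofReal θ ∧ ENNReal.ofReal θ < S + v} ≤ v := by
  rcases eq_or_ne S ∞ with rfl | hS
  · simp
  rcases eq_or_ne v ∞ with rfl | hv
  · simp
  lift S to ℝ≥0 using hS
  lift v to ℝ≥0 using hv
  have hm : MeasurableSet {θ : ℝ | (S : ℝ≥0∞) ≤ ENNReal.ofReal θ ∧ ENNReal.ofReal θ < S + v} :=
    (measurableSet_le measurable_const ENNReal.measurable_ofReal).inter
      (measurableSet_lt ENNReal.measurable_ofReal measurable_const)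
  rw [Measure.restrict_apply hm]
  calc _ ≤ volume (Ico (S : ℝ) (S + v)) := by
        refine measure_mono fun θ hθ => ?_
        obtain ⟨⟨h1, h2⟩, h3, -⟩ := hθ
        lift θ to ℝ≥0 using h3
        simp only [ENNReal.ofReal_coe_nnreal] at h1 h2
        exact ⟨by exact_mod_cast h1, by exact_mod_cast h2⟩
    _ = v := by simp

/-- A fractional cover of `E` by the cells of a tree can be rounded to a cover that is at most as
expensive: select the cells at which the weight accumulated from the root first exceeds a suitable
threshold. -/
theorem exists_tree_cover_le_of_fractional_cover {X α : Type*} [Countable α] (parent : α → α)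
    (cell : ℕ → X → α) (hpar : ∀ k x, parent (cell (k + 1) x) = cell k x) (E : Set X)
    (v : ℕ × α → ℝ≥0∞) (hv : ∀ x ∈ E, 1 ≤ ∑' k, v (k, cell k x)) (cost : ℕ × α → ℝ≥0∞) :
    ∃ J : Set (ℕ × α), (∀ x ∈ E, ∃ k, (k, cell k x) ∈ J) ∧
      ∑' p, J.indicator cost p ≤ ∑' p, v p * cost p := by
  -- The weight of the strict ancestors of a cell. It depends on the cell alone, so one threshold
  -- selects cells consistently for all points.
  let S : ℕ → α → ℝ≥0∞ := fun k => Nat.rec (fun _ => 0)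
    (fun j f a => f (parent a) + v (j, parent a)) k
  have hS0 a : S 0 a = 0 := rfl
  have hS k x : S (k + 1) (cell (k + 1) x) = S k (cell k x) + v (k, cell k x) := by
    rw [← hpar k x]
  have hSsum k x : S k (cell k x) = ∑ j ∈ Finset.range k, v (j, cell j x) := by
    induction k with
    | zero => simp [hS0]
    | succ k ih => rw [hS, ih, Finset.sum_range_succ]
  clear_value S
  let I : ℕ × α → Set ℝ := fun p =>
    {θ | S p.1 p.2 ≤ ENNReal.ofReal θ ∧ ENNReal.ofReal θ < S p.1 p.2 + v p}
  have hI p : MeasurableSet (I p) :=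
    (measurableSet_le measurable_const ENNReal.measurable_ofReal).inter
      (measurableSet_lt ENNReal.measurable_ofReal measurable_const)
  let μ := volume.restrict (Ico (0 : ℝ) 1)
  have : IsProbabilityMeasure μ := ⟨by simp [μ]⟩
  have hmeas p : Measurable ((I p).indicator fun _ => cost p) := measurable_const.indicator (hI p)
  have hnull : μ (Ico (0 : ℝ) 1)ᶜ = 0 := by
    rw [Measure.restrict_apply measurableSet_Ico.compl]; simp
  -- For `θ` uniform in `[0, 1)`, cell `p` is selected with probability at most `v p`; some `θ` does
  -- no worse than the average.
  obtain ⟨θ, hθ, hle⟩ := exists_notMem_null_le_lintegral (μ := μ)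
    (f := fun θ => ∑' p, (I p).indicator (fun _ => cost p) θ)
    (Measurable.tsum hmeas).aemeasurable hnull
  rw [notMem_compl_iff] at hθ
  refine ⟨{p | θ ∈ I p}, fun x hx => ?_, ?_⟩
  · have hex : ∃ k, ENNReal.ofReal θ < S k (cell k x) := by
      have h1 : ENNReal.ofReal θ < ∑' k, v (k, cell k x) := by
        refine lt_of_lt_of_le ?_ (hv x hx)
        rw [← ENNReal.ofReal_one]
        exact (ENNReal.ofReal_lt_ofReal_iff one_pos).2 hθ.2
      rw [ENNReal.tsum_eq_iSup_nat] at h1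
      obtain ⟨k, hk⟩ := lt_iSup_iff.1 h1
      exact ⟨k, by rwa [hSsum]⟩
    classical
    -- Since `S` omits the cell's own weight, the threshold is crossed at level `n - 1`.
    obtain ⟨n, hn, hmin⟩ : ∃ n, ENNReal.ofReal θ < S n (cell n x) ∧
        ∀ j < n, ¬ ENNReal.ofReal θ < S j (cell j x) :=
      ⟨Nat.find hex, Nat.find_spec hex, fun j => Nat.find_min hex⟩
    cases n with
    | zero => simp [hS0] at hn
    | succ k => exact ⟨k, not_lt.1 (hmin k k.lt_succ_self), by rwa [← hS]⟩
  · calc _ = ∑' p, (I p).indicator (fun _ => cost p) θ := by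
          refine tsum_congr fun p => ?_
          by_cases h : θ ∈ I p <;> simp [indicator, h]
      _ ≤ ∑' p, ∫⁻ θ, (I p).indicator (fun _ => cost p) θ ∂μ := by
          rwa [← lintegral_tsum fun p => (hmeas p).aemeasurable]
      _ ≤ _ := by
          refine ENNReal.tsum_le_tsum fun p => ?_
          rw [lintegral_indicator_const (hI p), mul_comm]
          gcongr
          exact volume_ofReal_mem_Ico_le _ _

/-! ### Dyadic cubes and weighted covers -/

/-- The index of the dyadic cube of side `2⁻ᵏ` that contains `x`. -/
noncomputable def dyadicIndex {m : ℕ} (k : ℕ) (x : EuclideanSpace ℝ (Fin m)) : Fin m → ℤ :=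
  fun j => ⌊(2 : ℝ) ^ k * x j⌋

theorem dyadicIndex_succ_div_two {m : ℕ} (k : ℕ) (x : EuclideanSpace ℝ (Fin m)) :
    (fun j => dyadicIndex (k + 1) x j / 2) = dyadicIndex k x := by
  funext j
  have := Int.floor_div_natCast ((2 : ℝ) ^ (k + 1) * x j) 2
  simp only [Nat.cast_ofNat] at this
  rw [dyadicIndex, dyadicIndex, ← this]
  congr 1
  ring

theorem edist_le_of_dyadicIndex_eq {m : ℕ} {k : ℕ} {x y : EuclideanSpace ℝ (Fin m)}
    (h : dyadicIndex k x = dyadicIndex k y) :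
    edist x y ≤ (((m + 1) * (1 / 2) ^ k : ℝ≥0) : ℝ≥0∞) := by
  rw [edist_nndist, ENNReal.coe_le_coe, ← NNReal.coe_le_coe, coe_nndist, EuclideanSpace.dist_eq]
  push_cast
  have hj j : dist (x j) (y j) ≤ (1 / 2) ^ k := by
    have h1 := (Int.abs_sub_lt_one_of_floor_eq_floor (congrFun h j)).le
    rw [← mul_sub, abs_mul, abs_of_pos (by positivity)] at h1
    rw [Real.dist_eq, one_div, inv_pow, ← one_div, le_div_iff₀' (by positivity)]
    exact h1
  -- The natural factor `√m` is replaced by `m + 1`, which stays positive for `m = 0`.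
  have hm : (m : ℝ) ≤ (m + 1) ^ 2 := by nlinarith [(Nat.cast_nonneg m : (0 : ℝ) ≤ m)]
  refine Real.sqrt_le_iff.2 ⟨by positivity, ?_⟩
  calc ∑ j, dist (x j) (y j) ^ 2 ≤ ∑ _j : Fin m, ((1 / 2 : ℝ) ^ k) ^ 2 := by
        gcongr with j; exact hj j
    _ = m * ((1 / 2 : ℝ) ^ k) ^ 2 := by simp
    _ ≤ (m + 1) ^ 2 * ((1 / 2 : ℝ) ^ k) ^ 2 := by gcongr
    _ = _ := by ring

theorem dyadicIndex_mem_Icc {m : ℕ} {k : ℕ} {x y : EuclideanSpace ℝ (Fin m)}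
    (h : dist y x ≤ (1 / 2) ^ k) :
    dyadicIndex k y ∈ Icc (dyadicIndex k x - 1) (dyadicIndex k x + 1) := by
  have hj j : |(2 : ℝ) ^ k * y j - 2 ^ k * x j| ≤ 1 := by
    have h1 : |y j - x j| ≤ (1 / 2) ^ k := by
      have := PiLp.norm_apply_le (y - x) j
      rw [← dist_eq_norm] at this
      simpa using this.trans h
    rw [← mul_sub, abs_mul, abs_of_pos (by positivity)]
    rwa [one_div, inv_pow, ← one_div, le_div_iff₀' (by positivity)] at h1
  refine ⟨fun j => ?_, fun j => ?_⟩ <;>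
    simp only [dyadicIndex, Pi.sub_apply, Pi.add_apply, Pi.one_apply] <;> have := abs_le.1 (hj j)
  · rw [← Int.floor_sub_one]
    exact Int.floor_mono (by linarith)
  · rw [← Int.floor_add_one]
    exact Int.floor_mono (by linarith)

theorem encard_dyadicIndex_image_le {m : ℕ} {k : ℕ} {A : Set (EuclideanSpace ℝ (Fin m))}
    (h : ediam A ≤ (((1 / 2) ^ k : ℝ≥0) : ℝ≥0∞)) : (dyadicIndex k '' A).encard ≤ 3 ^ m := by
  rcases A.eq_empty_or_nonempty with rfl | ⟨x, hx⟩
  · simp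
  calc (dyadicIndex k '' A).encard
      ≤ (Icc (dyadicIndex k x - 1) (dyadicIndex k x + 1)).encard := by
        refine encard_le_encard ?_
        rintro _ ⟨y, hy, rfl⟩
        refine dyadicIndex_mem_Icc ?_
        have := (edist_le_ediam_of_mem hy hx).trans h
        rw [edist_nndist, ENNReal.coe_le_coe, ← NNReal.coe_le_coe, coe_nndist] at this
        simpa using this
    _ = 3 ^ m := by
        rw [← Finset.coe_Icc, encard_coe_eq_coe_finsetCard, Pi.card_Icc]
        have h3 j : (Finset.Icc ((dyadicIndex k x - 1) j) ((dyadicIndex k x + 1) j)).card = 3 := by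
          rw [Int.card_Icc]
          simp only [Pi.sub_apply, Pi.add_apply, Pi.one_apply]
          omega
        rw [Finset.prod_congr rfl fun j _ => h3 j]
        simp

theorem exists_half_pow_near {r : ℝ≥0} (h0 : 0 < r) (h1 : r ≤ 1) :
    ∃ k : ℕ, (1 / 2 : ℝ≥0) ^ (k + 1) < r ∧ r ≤ (1 / 2) ^ k := by
  obtain ⟨k, hk, hk'⟩ := exists_nat_pow_near_of_lt_one (x := (r : ℝ)) (y := 1 / 2) h0 h1
    (by norm_num) (by norm_num)
  refine ⟨k, ?_, ?_⟩
  · rw [← NNReal.coe_lt_coe]; push_cast; exact hk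
  · rw [← NNReal.coe_le_coe]; push_cast; exact hk'

/-- Sets of positive Hausdorff measure cannot be cheaply covered even fractionally. -/
theorem exists_pos_le_tsum_mul_of_hausdorffMeasure_ne_zero {m : ℕ} {s : ℝ} (hs : 0 ≤ s)
    {E : Set (EuclideanSpace ℝ (Fin m))} (h : Measure.hausdorffMeasure s E ≠ 0) :
    ∃ c : ℝ≥0, 0 < c ∧ ∀ (A : ℕ → Set (EuclideanSpace ℝ (Fin m))) (r : ℕ → ℝ≥0) (w : ℕ → ℝ≥0∞),
      (∀ i, 0 < r i) → (∀ i, r i ≤ 1) → (∀ i, ediam (A i) ≤ r i) →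
      (∀ x ∈ E, 1 ≤ ∑' i, {i | x ∈ A i}.indicator w i) →
      (c : ℝ≥0∞) ≤ ∑' i, w i * (r i : ℝ≥0∞) ^ s := by
  classical
  obtain ⟨c, hc, hcont⟩ := exists_pos_le_tsum_of_hausdorffMeasure_ne_zero hs h
  -- The factors account for the diameter of a cube, the number of cubes meeting `A i`, and the
  -- rounding of `r i` up to a power of `1 / 2`.
  let K : ℝ≥0 := (m + 1) ^ s * 3 ^ m * 2 ^ s
  have hK : 0 < K := by positivity
  refine ⟨c / K, by positivity, fun A r w hr0 hr1 hA hw => ?_⟩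
  choose k hk hk' using fun i => exists_half_pow_near (hr0 i) (hr1 i)
  let N : ℕ → Set (ℕ × (Fin m → ℤ)) := fun i => {k i} ×ˢ (dyadicIndex (k i) '' A i)
  -- Each `A i` passes its whole weight to every cube of its own scale that it meets, so points of
  -- `E` still receive total weight at least one.
  let v : ℕ × (Fin m → ℤ) → ℝ≥0∞ := fun p => ∑' i, {i | p ∈ N i}.indicator w i
  let cost : ℕ × (Fin m → ℤ) → ℝ≥0∞ := fun p => (((1 / 2) ^ p.1 : ℝ≥0) : ℝ≥0∞) ^ s
  obtain ⟨J, hJ, hle⟩ := exists_tree_cover_le_of_fractional_cover (fun a j => a j / 2)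
    (fun k x => dyadicIndex k x) dyadicIndex_succ_div_two E v (fun x hx => by
      refine (hw x hx).trans ?_
      rw [ENNReal.tsum_comm]
      refine ENNReal.tsum_le_tsum fun i => ?_
      refine le_trans ?_ (ENNReal.le_tsum (k i))
      by_cases hi : x ∈ A i
      · have : (k i, dyadicIndex (k i) x) ∈ N i := ⟨rfl, x, hi, rfl⟩
        simp [indicator, hi, this]
      · simp [indicator, hi]) cost
  have h1 : (c : ℝ≥0∞) ≤ (m + 1 : ℝ≥0) ^ s * ∑' p, J.indicator cost p := by
    refine (hcont J (fun p => {x | dyadicIndex p.1.1 x = p.1.2})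
      (fun p => (m + 1) * (1 / 2) ^ p.1.1) (fun p => ediam_le fun x hx y hy =>
        edist_le_of_dyadicIndex_eq (hx.trans hy.symm)) fun x hx => ?_).trans_eq ?_
    · obtain ⟨k, hk⟩ := hJ x hx
      exact mem_iUnion.2 ⟨⟨_, hk⟩, rfl⟩
    · rw [← tsum_subtype, ← ENNReal.tsum_mul_left]
      refine tsum_congr fun p => ?_
      rw [ENNReal.coe_mul, ENNReal.mul_rpow_of_nonneg _ _ hs]
  have h2 : ∑' p, v p * cost p ≤ ∑' i, w i * (3 ^ m * (2 ^ s * (r i : ℝ≥0∞) ^ s)) := by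
    simp_rw [v, ← ENNReal.tsum_mul_right]
    rw [ENNReal.tsum_comm]
    refine ENNReal.tsum_le_tsum fun i => ?_
    calc ∑' p, {i | p ∈ N i}.indicator w i * cost p
        = ∑' p, (N i).indicator (fun _ => w i * (((1 / 2) ^ k i : ℝ≥0) : ℝ≥0∞) ^ s) p := by
          refine tsum_congr fun p => ?_
          by_cases hp : p ∈ N i
          · have : p.1 = k i := hp.1
            simp [indicator, hp, cost, this]
          · simp [indicator, hp]
      _ = (N i).encard * (w i * (((1 / 2) ^ k i : ℝ≥0) : ℝ≥0∞) ^ s) := by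
          rw [← tsum_subtype, ENNReal.tsum_const, ENat.card_coe_set_eq]
      _ ≤ 3 ^ m * (w i * (2 * r i : ℝ≥0) ^ s) := by
          gcongr
          · have : (N i).encard ≤ 3 ^ m := by
              rw [encard_prod, encard_singleton, one_mul]
              exact encard_dyadicIndex_image_le ((hA i).trans (by exact_mod_cast hk' i))
            exact_mod_cast ENat.toENNReal_le.2 this
          · have := hk i
            rw [pow_succ] at this
            rw [← NNReal.coe_le_coe]
            rw [← NNReal.coe_lt_coe] at this
            push_cast at this ⊢
            linarith
      _ = _ := by
          rw [ENNReal.coe_mul, ENNReal.mul_rpow_of_nonneg _ _ hs]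
          push_cast
          ring
  rw [ENNReal.coe_div hK.ne']
  refine ENNReal.div_le_of_le_mul' ((h1.trans (mul_le_mul_right (hle.trans h2) _)).trans_eq ?_)
  rw [← ENNReal.tsum_mul_left, ← ENNReal.tsum_mul_left]
  refine tsum_congr fun i => ?_
  simp only [K, ENNReal.coe_mul, ENNReal.coe_rpow_of_nonneg _ hs, ENNReal.coe_pow, ENNReal.coe_ofNat]
  ring

/-! ### Packing numbers and packing dimension -/

theorem packingNumber_antitone {X : Type*} [MetricSpace X] {r r' : ℝ≥0} (h : r' ≤ r) (A : Set X) :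
    packingNumber r A ≤ packingNumber r' A :=
  iSup₂_mono fun _ _ => iSup_mono' fun hC => ⟨hC.anti (by exact_mod_cast h), le_rfl⟩

theorem packingNumber_mul_le {X : Type*} [MetricSpace X] {A : Set X} {r : ℝ≥0} {a M : ℝ≥0∞}
    (h : ∀ D : Finset X, (D : Set X) ⊆ A → IsSeparated r (D : Set X) → (D.card : ℝ≥0∞) * a ≤ M) :
    (packingNumber r A : ℝ≥0∞) * a ≤ M := by
  by_cases hN : packingNumber r A = ⊤
  · have hn (n : ℕ) : (n : ℝ≥0∞) * a ≤ M := by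
      have h1 : (n : ℕ∞) < packingNumber r A := by rw [hN]; exact ENat.natCast_lt_top n
      simp only [packingNumber, lt_iSup_iff] at h1
      obtain ⟨C, hCA, hC, hlt⟩ := h1
      obtain ⟨D, hDC, hD⟩ := exists_subset_encard_eq hlt.le
      have hfin : D.Finite := finite_of_encard_eq_coe hD
      have := h hfin.toFinset (by simpa using hDC.trans hCA) (by simpa using hC.subset hDC)
      rw [hfin.encard_eq_coe_toFinset_card] at hD
      rwa [Nat.cast_inj.1 hD] at this
    rw [hN, ENat.toENNReal_top, ← ENNReal.iSup_natCast, ENNReal.iSup_mul]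
    exact iSup_le hn
  · obtain ⟨C, hCA, hfin, hC, hcard⟩ := exists_set_encard_eq_packingNumber hN
    have := h hfin.toFinset (by simpa using hCA) (by simpa using hC)
    rw [← hcard, hfin.encard_eq_coe_toFinset_card]
    simpa using this

/-- The `r`-packing numbers of `A` are `O(r⁻ˢ)`. -/
def PackingNumberBound {X : Type*} [MetricSpace X] (s : ℝ≥0) (A : Set X) : Prop :=
  ∃ C : ℝ≥0, ∀ r : ℝ≥0, 0 < r → r ≤ 1 →
    (packingNumber r A : ℝ≥0∞) * (r : ℝ≥0∞) ^ (s : ℝ) ≤ C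

theorem PackingNumberBound.packingNumber_ne_top {X : Type*} [MetricSpace X] {s : ℝ≥0} {A : Set X}
    (h : PackingNumberBound s A) {r : ℝ≥0} (h0 : 0 < r) (h1 : r ≤ 1) : packingNumber r A ≠ ⊤ := by
  obtain ⟨C, hC⟩ := h
  intro htop
  have := hC r h0 h1
  rw [htop, ENat.toENNReal_top, ENNReal.top_mul] at this
  · simp at this
  · rw [← ENNReal.coe_rpow_of_nonneg _ s.coe_nonneg]
    exact_mod_cast (NNReal.rpow_pos h0).ne'

theorem sum_ediam_ball_le_packingPreDelta {X : Type*} [MetricSpace X] (s : ℝ≥0) {A : Set X} {ρ : ℝ}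
    (hρ : 0 < ρ) {D : Finset X} (hD : (D : Set X) ⊆ A)
    (hdisj : (D : Set X).PairwiseDisjoint fun x => ball x ρ) :
    ∑ x ∈ D, ediam (ball x ρ) ^ (s : ℝ) ≤ packingPreDelta s (2 * ρ) A := by
  rcases D.eq_empty_or_nonempty with rfl | ⟨x₀, hx₀⟩
  · simp
  let e := D.equivFin
  let x : ℕ → X := fun i => if h : i < D.card then e.symm ⟨i, h⟩ else x₀
  -- Radius zero makes the balls beyond the finite family empty, so they are disjoint from
  -- everything.
  let τ : ℕ → ℝ := fun i => if i < D.card then ρ else 0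
  have hp : IsBallPacking A (2 * ρ) x τ := by
    refine ⟨fun i => ?_, fun i => ?_, fun i j hij => ?_⟩
    · by_cases h : i < D.card
      · simpa [x, h] using hD (e.symm ⟨i, h⟩).2
      · simpa [x, h] using hD hx₀
    · by_cases h : i < D.card <;> simp [τ, h, hρ.le]
    · by_cases hi : i < D.card
      · by_cases hj : j < D.card
        · simp only [x, τ, hi, hj, dif_pos, if_pos]
          refine hdisj (e.symm ⟨i, hi⟩).2 (e.symm ⟨j, hj⟩).2 fun h => hij ?_
          simpa using e.symm.injective (Subtype.ext h)
        · simp [τ, hj]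
      · simp [τ, hi]
  refine le_trans ?_ (le_iSup_of_le x (le_iSup_of_le τ (le_iSup_of_le hp le_rfl)))
  refine le_trans ?_ (ENNReal.sum_le_tsum (Finset.range D.card))
  rw [← Finset.sum_coe_sort, ← Fin.sum_univ_eq_sum_range (fun i => ⨆ _ : (ball (x i) (τ i)).Nonempty,
    ediam (ball (x i) (τ i)) ^ (s : ℝ)), ← e.symm.sum_comp]
  refine Finset.sum_le_sum fun i _ => ?_
  have hx : x i = e.symm i := by simp [x]
  have hτ : τ i = ρ := by simp [τ]
  rw [hx, hτ]
  exact le_iSup_of_le (nonempty_ball.2 hρ) le_rfl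

/-- Balls of radius `r / 2` about `r`-separated points are disjoint, and by `hX` each has diameter
at least `r`, so they form a packing that bounds the packing number for `r ≤ δ`. For `δ ≤ r ≤ 1` the
packing number is at most the one at `δ`. -/
theorem packingNumberBound_of_packingPre_ne_top {X : Type*} [MetricSpace X]
    (hX : ∀ (x : X) (r : ℝ≥0), (r : ℝ≥0∞) ≤ ediam (ball x (r / 2))) {s : ℝ≥0} {A : Set X}
    (h : packingPre s A ≠ ∞) : PackingNumberBound s A := by
  obtain ⟨δ, h⟩ := iInf_lt_iff.1 (lt_top_iff_ne_top.2 h)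
  obtain ⟨hδ, h⟩ := iInf_lt_iff.1 h
  have key (r : ℝ≥0) (hr : 0 < r) (hrδ : r ≤ δ) :
      (packingNumber r A : ℝ≥0∞) * (r : ℝ≥0∞) ^ (s : ℝ) ≤ packingPreDelta s δ A := by
    refine packingNumber_mul_le fun D hDA hD => ?_
    have hr' : (0 : ℝ) < r := hr
    calc (D.card : ℝ≥0∞) * (r : ℝ≥0∞) ^ (s : ℝ) = ∑ _x ∈ D, (r : ℝ≥0∞) ^ (s : ℝ) := by simp
      _ ≤ ∑ x ∈ D, ediam (ball x (r / 2)) ^ (s : ℝ) := by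
          gcongr with x hx; exact hX x r
      _ ≤ packingPreDelta s (2 * (r / 2)) A := by
          refine sum_ediam_ball_le_packingPreDelta s (by positivity) hDA fun x hx y hy hxy => ?_
          refine ball_disjoint_ball ?_
          have : (r : ℝ≥0∞) < edist x y := hD hx hy hxy
          rw [edist_nndist, ENNReal.coe_lt_coe, ← NNReal.coe_lt_coe, coe_nndist] at this
          linarith
      _ ≤ _ := packingPreDelta_mono s A (by linarith)
  lift δ to ℝ≥0 using hδ.le
  have hδ' : 0 < δ := hδ
  lift packingPreDelta s δ A to ℝ≥0 using h.ne with M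
  have hm : 0 < min δ 1 := lt_min hδ' one_pos
  have hms : (min δ 1) ^ (s : ℝ) ≤ 1 := NNReal.rpow_le_one (min_le_right _ _) s.coe_nonneg
  have hms' : 0 < (min δ 1) ^ (s : ℝ) := NNReal.rpow_pos hm
  refine ⟨M / (min δ 1) ^ (s : ℝ), fun r hr hr1 => ?_⟩
  rcases le_total r δ with hrδ | hrδ
  · refine (key r hr hrδ).trans ?_
    rw [ENNReal.coe_le_coe]
    exact le_div_self bot_le hms' hms
  · have hd1 : δ ≤ 1 := hrδ.trans hr1
    rw [min_eq_left hd1] at *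
    rw [ENNReal.coe_div hms'.ne', ENNReal.coe_rpow_of_nonneg _ s.coe_nonneg,
      ENNReal.le_div_iff_mul_le (Or.inl ?_) (Or.inl ?_)]
    · refine le_trans ?_ (key δ hδ' le_rfl)
      gcongr
      calc (packingNumber r A : ℝ≥0∞) * (r : ℝ≥0∞) ^ (s : ℝ) ≤ packingNumber r A * 1 := by
            gcongr
            exact ENNReal.rpow_le_one (by exact_mod_cast hr1) s.coe_nonneg
        _ ≤ packingNumber δ A := by
            rw [mul_one]
            exact_mod_cast packingNumber_antitone hrδ A
    · rw [← ENNReal.coe_rpow_of_nonneg _ s.coe_nonneg]; exact_mod_cast hms'.ne'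
    · rw [← ENNReal.coe_rpow_of_nonneg _ s.coe_nonneg]; exact ENNReal.coe_ne_top

theorem packingNumberBound_of_subsingleton {X : Type*} [MetricSpace X] [Subsingleton X] (s : ℝ≥0)
    (A : Set X) : PackingNumberBound s A := by
  refine ⟨1, fun r _ hr => ?_⟩
  calc (packingNumber r A : ℝ≥0∞) * (r : ℝ≥0∞) ^ (s : ℝ) ≤ 1 * 1 := by
        gcongr
        · have : packingNumber r A ≤ 1 := (packingNumber_le_encard_self A).trans
            (encard_le_one_iff_subsingleton.2 subsingleton_of_subsingleton)
          exact_mod_cast ENat.toENNReal_le.2 this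
        · exact ENNReal.rpow_le_one (by exact_mod_cast hr) s.coe_nonneg
    _ = _ := by simp

theorem packingNumberBound_of_packingPre_ne_top_euclidean {n : ℕ} {s : ℝ≥0}
    {A : Set (EuclideanSpace ℝ (Fin n))} (h : packingPre s A ≠ ∞) : PackingNumberBound s A := by
  -- In dimension zero balls have diameter zero, so the diameter hypothesis fails there.
  rcases n.eq_zero_or_pos with rfl | hn
  · exact packingNumberBound_of_subsingleton s A
  · have : Nonempty (Fin n) := ⟨⟨0, hn⟩⟩
    refine packingNumberBound_of_packingPre_ne_top (fun x r => ?_) h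
    have h1 := diam_ball_eq x (r := (r : ℝ) / 2) (by positivity)
    rw [mul_div_cancel₀ _ two_ne_zero] at h1
    calc (r : ℝ≥0∞) = ENNReal.ofReal (diam (ball x (r / 2 : ℝ))) := by
          rw [h1, ENNReal.ofReal_coe_nnreal]
      _ ≤ _ := ENNReal.ofReal_toReal_le

theorem exists_cover_packingNumberBound_of_dimP_lt {n : ℕ} {t : ℝ≥0}
    {A : Set (EuclideanSpace ℝ (Fin n))} (h : dimP A < t) :
    ∃ T : ℕ → Set (EuclideanSpace ℝ (Fin n)), A ⊆ ⋃ i, T i ∧ ∀ i, PackingNumberBound t (T i) := by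
  have ht : packingMeasure t A < ∞ := by
    rw [dimP_eq_iInf] at h
    simp only [iInf_lt_iff] at h
    obtain ⟨t', h0, hlt⟩ := h
    rw [packingMeasure_eq_zero (by exact_mod_cast hlt) (by simp [h0])]
    exact ENNReal.zero_lt_top
  simp only [packingMeasure, iInf_lt_iff] at ht
  obtain ⟨T, hT, hsum⟩ := ht
  exact ⟨T, hT, fun i => packingNumberBound_of_packingPre_ne_top_euclidean
    (ENNReal.ne_top_of_tsum_ne_top hsum.ne i)⟩

/-- Group the balls of a packing by dyadic size of radius. Centres in one group are separated at
that scale, hence number `O(2^(ks))`, and each ball contributes `O(2^(-kt))`; the geometric series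
converges because `s < t`. -/
theorem PackingNumberBound.packingPre_ne_top {X : Type*} [MetricSpace X] {s t : ℝ≥0} (hst : s < t)
    {A : Set X} (h : PackingNumberBound s A) : packingPre t A ≠ ∞ := by
  obtain ⟨C, hC⟩ := h
  have hd : (0 : ℝ) < t - s := sub_pos.2 (by exact_mod_cast hst)
  have ht : (0 : ℝ) < t := by exact_mod_cast bot_le.trans_lt hst
  let q : ℝ≥0∞ := ((1 / 2 : ℝ≥0) : ℝ≥0∞) ^ ((t : ℝ) - s)
  have hq : q < 1 := by
    refine ENNReal.rpow_lt_one ?_ hd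
    exact_mod_cast (by norm_num : (1 / 2 : ℝ≥0) < 1)
  have hfin : (C : ℝ≥0∞) * 4 ^ (t : ℝ) * (q * (1 - q)⁻¹) ≠ ∞ := by
    refine ENNReal.mul_ne_top (ENNReal.mul_ne_top ENNReal.coe_ne_top ?_) (ENNReal.mul_ne_top ?_ ?_)
    · exact ENNReal.rpow_ne_top_of_nonneg ht.le (by simp)
    · exact hq.ne_top
    · exact ENNReal.inv_ne_top.2 (tsub_pos_of_lt hq).ne'
  refine ne_top_of_le_ne_top hfin ((iInf₂_le 1 one_pos).trans ?_)
  refine iSup_le fun x => iSup_le fun ρ => iSup_le fun hp => ?_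
  let I : ℕ → Set ℕ := fun k => {i | (1 / 2 : ℝ) ^ (k + 1) < ρ i ∧ ρ i ≤ (1 / 2) ^ k}
  have hcard k : ((I k).encard : ℝ≥0∞) * (((1 / 2 : ℝ≥0) ^ (k + 1) : ℝ≥0) : ℝ≥0∞) ^ (s : ℝ) ≤ C := by
    refine le_trans ?_ (hC ((1 / 2) ^ (k + 1)) (by positivity)
      (pow_le_one₀ (by positivity) (by norm_num [← NNReal.coe_le_coe])))
    gcongr
    have hdist : ∀ i ∈ I k, ∀ j ∈ I k, i ≠ j → (1 / 2 : ℝ) ^ (k + 1) < dist (x i) (x j) := by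
      intro i hi j hj hij
      refine hi.1.trans_le ?_
      -- Otherwise the centre of the `j`-th ball would lie in the `i`-th one.
      by_contra! hlt
      have hj0 : 0 < ρ j := lt_trans (by positivity) hj.1
      exact Set.disjoint_left.1 (hp.disjoint i j hij) (mem_ball'.2 hlt) (mem_ball_self hj0)
    have hinj : InjOn x (I k) := fun i hi j hj hxy => by
      by_contra hij
      have := hdist i hi j hj hij
      rw [hxy, dist_self] at this
      exact absurd this (not_lt.2 (by positivity))
    rw [← hinj.encard_image]
    refine IsSeparated.encard_le_packingNumber ?_ ?_
    · rintro _ ⟨i, -, rfl⟩; exact hp.center_mem i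
    · rintro _ ⟨i, hi, rfl⟩ _ ⟨j, hj, rfl⟩ hij
      rw [edist_nndist, ENNReal.coe_lt_coe, ← NNReal.coe_lt_coe, coe_nndist]
      push_cast
      exact hdist i hi j hj fun h => hij (by rw [h])
  have hball k i (hi : i ∈ I k) : ediam (ball (x i) (ρ i)) ^ (t : ℝ) ≤
      4 ^ (t : ℝ) * (((1 / 2 : ℝ≥0) ^ (k + 1) : ℝ≥0) : ℝ≥0∞) ^ (t : ℝ) := by
    rw [← ENNReal.mul_rpow_of_nonneg _ _ ht.le]
    refine ENNReal.rpow_le_rpow (ediam_le fun a ha b hb => ?_) ht.le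
    have h1 := mem_ball.1 ha
    have h2 := mem_ball'.1 hb
    have h3 := dist_triangle a (x i) b
    have h4 := hi.2
    have : nndist a b ≤ 4 * (1 / 2 : ℝ≥0) ^ (k + 1) := by
      rw [← NNReal.coe_le_coe, coe_nndist]
      push_cast
      rw [pow_succ]
      linarith
    rw [edist_nndist]
    exact_mod_cast this
  calc _ ≤ ∑' i, ∑' k, (I k).indicator
          (fun _ => 4 ^ (t : ℝ) * (((1 / 2 : ℝ≥0) ^ (k + 1) : ℝ≥0) : ℝ≥0∞) ^ (t : ℝ)) i := by
        refine ENNReal.tsum_le_tsum fun i => iSup_le fun hne => ?_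
        have hpos : 0 < ρ i := nonempty_ball.1 hne
        have hle := (hp.radius_mem i).2
        obtain ⟨k, hk, hk'⟩ := exists_nat_pow_near_of_lt_one (x := ρ i) (y := 1 / 2) hpos
          (by linarith) (by norm_num) (by norm_num)
        have hi : i ∈ I k := ⟨hk, hk'⟩
        refine (hball k i hi).trans ?_
        refine le_trans ?_ (ENNReal.le_tsum k)
        rw [indicator_of_mem hi]
    _ = ∑' k, ((I k).encard : ℝ≥0∞) *
          (4 ^ (t : ℝ) * (((1 / 2 : ℝ≥0) ^ (k + 1) : ℝ≥0) : ℝ≥0∞) ^ (t : ℝ)) := by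
        rw [ENNReal.tsum_comm]
        refine tsum_congr fun k => ?_
        rw [← tsum_subtype, ENNReal.tsum_const, ENat.card_coe_set_eq]
    _ ≤ ∑' k : ℕ, C * 4 ^ (t : ℝ) * q ^ (k + 1) := by
        refine ENNReal.tsum_le_tsum fun k => ?_
        have hsplit : (((1 / 2 : ℝ≥0) ^ (k + 1) : ℝ≥0) : ℝ≥0∞) ^ (t : ℝ) =
            (((1 / 2 : ℝ≥0) ^ (k + 1) : ℝ≥0) : ℝ≥0∞) ^ (s : ℝ) * q ^ (k + 1) := by
          have : q ^ (k + 1) = (((1 / 2 : ℝ≥0) ^ (k + 1) : ℝ≥0) : ℝ≥0∞) ^ ((t : ℝ) - s) := by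
            rw [ENNReal.coe_pow, ← ENNReal.rpow_natCast, ← ENNReal.rpow_natCast,
              ← ENNReal.rpow_mul, ← ENNReal.rpow_mul, mul_comm]
          rw [this, ← ENNReal.rpow_add_of_nonneg _ _ s.coe_nonneg hd.le, add_sub_cancel]
        rw [hsplit]
        calc _ = ((I k).encard : ℝ≥0∞) * (((1 / 2 : ℝ≥0) ^ (k + 1) : ℝ≥0) : ℝ≥0∞) ^ (s : ℝ) *
              (4 ^ (t : ℝ) * q ^ (k + 1)) := by ring
          _ ≤ C * (4 ^ (t : ℝ) * q ^ (k + 1)) := by gcongr; exact hcard k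
          _ = _ := by ring
    _ = _ := by rw [ENNReal.tsum_mul_left, ENNReal.tsum_geometric_add_one]

theorem dimP_le_of_subset_iUnion {X : Type*} [MetricSpace X] {ι : Type*} [Countable ι] [Nonempty ι]
    {s : ℝ≥0} {A : Set X} {T : ι → Set X} (hA : A ⊆ ⋃ i, T i)
    (hT : ∀ i, PackingNumberBound s (T i)) : dimP A ≤ s := by
  obtain ⟨e, he⟩ := exists_surjective_nat ι
  rw [dimP_eq_iInf]
  refine ENNReal.le_of_forall_pos_le_add fun ε hε _ => ?_
  rw [← ENNReal.coe_add]
  -- The exponent is raised twice: once to make the premeasure of each piece finite, once to make it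
  -- zero.
  have h1 : s < s + ε / 2 := lt_add_of_pos_right s (half_pos hε)
  have h2 : s + ε / 2 < s + ε := add_lt_add_right (NNReal.half_lt_self hε.ne') s
  have h0 : packingMeasure (s + ε) A ≤ 0 := by
    refine iInf₂_le_of_le (T ∘ e) ?_ ?_
    · rwa [Function.comp_def, he.iUnion_comp T]
    · simp [fun i => packingPre_eq_zero h2 ((hT (e i)).packingPre_ne_top h1)]
  exact iInf₂_le_of_le (s + ε) (le_antisymm h0 bot_le) le_rfl

/-! ### Products: Hausdorff dimension from below -/

/-- The maps `p` and `q` identify `Z` with `X × Y`, the distance of `Z` lying between the maximum and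
the sum of the distances of the factors. -/
structure IsProductMetric {X Y Z : Type*} [MetricSpace X] [MetricSpace Y] [MetricSpace Z]
    (p : Z → X) (q : Z → Y) : Prop where
  edist_fst_le : ∀ z w, edist (p z) (p w) ≤ edist z w
  edist_snd_le : ∀ z w, edist (q z) (q w) ≤ edist z w
  edist_le : ∀ z w, edist z w ≤ edist (p z) (p w) + edist (q z) (q w)
  exists_eq : ∀ x y, ∃ z, p z = x ∧ q z = y

theorem le_tsum_indicator_of_cover {Y : Type*} {F : Set Y} {t : ℝ} {c : ℝ≥0} {r : ℕ → ℝ≥0}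
    [MetricSpace Y] (hc : ∀ (ι : Type) [Countable ι] (S : ι → Set Y) (r : ι → ℝ≥0),
      (∀ i, ediam (S i) ≤ r i) → F ⊆ ⋃ i, S i → (c : ℝ≥0∞) ≤ ∑' i, (r i : ℝ≥0∞) ^ t)
    {S : ℕ → Set Y} (J : Set ℕ) (hS : ∀ i, ediam (S i) ≤ r i) (hF : F ⊆ ⋃ i ∈ J, S i) :
    (c : ℝ≥0∞) ≤ ∑' i, J.indicator (fun i => (r i : ℝ≥0∞) ^ t) i := by
  rw [← tsum_subtype]
  exact hc J (fun i => S i) (fun i => r i) (fun i => hS i) (by rwa [biUnion_eq_iUnion] at hF)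

theorem hausdorffMeasure_zero_ne_zero {X : Type*} [MetricSpace X] [MeasurableSpace X]
    [BorelSpace X] {A : Set X} (hA : A.Nonempty) : Measure.hausdorffMeasure 0 A ≠ 0 := by
  obtain ⟨x, hx⟩ := hA
  have h1 := measure_mono (μ := Measure.hausdorffMeasure 0) (singleton_subset_iff.2 hx)
  rw [Measure.hausdorffMeasure_zero_singleton] at h1
  exact (one_pos.trans_le h1).ne'

theorem dimH_le_iSup_hausdorffMeasure_ne_zero {X : Type*} [MetricSpace X] [MeasurableSpace X]
    [BorelSpace X] (A : Set X) :
    dimH A ≤ ⨆ s : {s : ℝ≥0 // Measure.hausdorffMeasure s A ≠ 0}, ((s : ℝ≥0) : ℝ≥0∞) :=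
  dimH_le fun s hs => le_iSup (fun s : {s : ℝ≥0 // Measure.hausdorffMeasure s A ≠ 0} =>
    ((s : ℝ≥0) : ℝ≥0∞)) ⟨s, by simp [hs]⟩

theorem le_add_of_forall_lt_of_forall_lt {a b d : ℝ≥0∞}
    (h : ∀ s t : ℝ≥0, a < s → b < t → d ≤ s + t) : d ≤ a + b := by
  refine ENNReal.le_of_forall_pos_le_add fun ε hε hfin => ?_
  lift a to ℝ≥0 using (ENNReal.add_lt_top.1 hfin).1.ne
  lift b to ℝ≥0 using (ENNReal.add_lt_top.1 hfin).2.ne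
  have hε2 : 0 < ε / 2 := half_pos hε
  refine (h (a + ε / 2) (b + ε / 2) (by exact_mod_cast lt_add_of_pos_right a hε2)
    (by exact_mod_cast lt_add_of_pos_right b hε2)).trans_eq ?_
  norm_cast
  rw [add_add_add_comm, add_halves]

namespace IsProductMetric

theorem ediam_le {X Y Z : Type*} [MetricSpace X] [MetricSpace Y] [MetricSpace Z] {p : Z → X}
    {q : Z → Y} (h : IsProductMetric p q) (A : Set X) (B : Set Y) :
    ediam {z | p z ∈ A ∧ q z ∈ B} ≤ ediam A + ediam B :=
  Metric.ediam_le fun z hz w hw => (h.edist_le z w).trans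
    (add_le_add (edist_le_ediam_of_mem hz.1 hw.1) (edist_le_ediam_of_mem hz.2 hw.2))

/-- A cheap cover of the product would induce a cheap fractional cover of `E`. Only the first factor
is Euclidean, since only there are dyadic cubes needed. -/
theorem hausdorffMeasure_add_ne_zero {m : ℕ} {Y Z : Type*} [MetricSpace Y] [MeasurableSpace Y]
    [BorelSpace Y] [MetricSpace Z] [MeasurableSpace Z] [BorelSpace Z]
    {p : Z → EuclideanSpace ℝ (Fin m)} {q : Z → Y} (h : IsProductMetric p q)
    {E : Set (EuclideanSpace ℝ (Fin m))} {F : Set Y} {s t : ℝ} (hs : 0 ≤ s) (ht : 0 ≤ t)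
    (hE : Measure.hausdorffMeasure s E ≠ 0) (hF : Measure.hausdorffMeasure t F ≠ 0) :
    Measure.hausdorffMeasure (s + t) {z | p z ∈ E ∧ q z ∈ F} ≠ 0 := by
  obtain ⟨a, ha, hEa⟩ := exists_pos_le_tsum_mul_of_hausdorffMeasure_ne_zero hs hE
  obtain ⟨b, hb, hFb⟩ := exists_pos_le_tsum_of_hausdorffMeasure_ne_zero ht hF
  rcases (add_nonneg hs ht).eq_or_lt with h0 | hst
  · rw [← h0]
    obtain ⟨x, hx⟩ := nonempty_of_measure_ne_zero hE
    obtain ⟨y, hy⟩ := nonempty_of_measure_ne_zero hF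
    obtain ⟨z, hzx, hzy⟩ := h.exists_eq x y
    exact hausdorffMeasure_zero_ne_zero ⟨z, by rwa [hzx], by rwa [hzy]⟩
  intro hG
  -- With total cost at most `a * b / 2`, the weights normalised by `b` yield `a ≤ a / 2`.
  have hε : ((a * b / 2 : ℝ≥0) : ℝ≥0∞) ≠ 0 := by
    exact_mod_cast (half_pos (mul_pos ha hb)).ne'
  obtain ⟨S, r, hcov, hr0, hr1, hS, hsum⟩ := exists_cover_of_hausdorffMeasure_eq_zero hst hG hε
  have hpS i : ediam (p '' S i) ≤ r i := by
    refine (Metric.ediam_le ?_).trans (hS i)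
    rintro _ ⟨z, hz, rfl⟩ _ ⟨w, hw, rfl⟩
    exact (h.edist_fst_le z w).trans (edist_le_ediam_of_mem hz hw)
  have hqS i : ediam (q '' S i) ≤ r i := by
    refine (Metric.ediam_le ?_).trans (hS i)
    rintro _ ⟨z, hz, rfl⟩ _ ⟨w, hw, rfl⟩
    exact (h.edist_snd_le z w).trans (edist_le_ediam_of_mem hz hw)
  have hb0 : (b : ℝ≥0∞) ≠ 0 := by exact_mod_cast hb.ne'
  -- For each `x ∈ E`, the `q '' S i` with `x ∈ p '' S i` cover `F`, so the weights at `x` sum to at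
  -- least one.
  have key := hEa (fun i => p '' S i) r (fun i => (b : ℝ≥0∞)⁻¹ * (r i : ℝ≥0∞) ^ t) hr0 hr1 hpS
    fun x hx => by
      have h1 := le_tsum_indicator_of_cover hFb {i | x ∈ p '' S i} hqS fun y hy => by
        obtain ⟨z, rfl, rfl⟩ := h.exists_eq x y
        obtain ⟨i, hi⟩ := mem_iUnion.1 (hcov ⟨hx, hy⟩)
        exact mem_biUnion (x := i) ⟨z, hi, rfl⟩ ⟨z, hi, rfl⟩
      simp_rw [Set.indicator_mul_right _ (fun _ => (b : ℝ≥0∞)⁻¹), ENNReal.tsum_mul_left]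
      rw [← ENNReal.inv_mul_cancel hb0 ENNReal.coe_ne_top]
      exact mul_le_mul_right h1 _
  have h2 : (a : ℝ≥0∞) ≤ (b : ℝ≥0∞)⁻¹ * ((a * b / 2 : ℝ≥0) : ℝ≥0∞) := by
    refine key.trans ?_
    refine le_trans (le_of_eq ?_) (mul_le_mul_right hsum _)
    rw [← ENNReal.tsum_mul_left]
    refine tsum_congr fun i => ?_
    rw [add_comm s t, ENNReal.rpow_add_of_nonneg _ _ ht hs, mul_assoc]
  rw [← ENNReal.coe_inv hb.ne', ← ENNReal.coe_mul, ENNReal.coe_le_coe] at h2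
  have h3 : b⁻¹ * (a * b / 2) = a / 2 := by field_simp
  rw [h3] at h2
  exact absurd h2 (not_le.2 (half_lt_self ha))

theorem dimH_add_dimH_le {m : ℕ} {Y Z : Type*} [MetricSpace Y] [MetricSpace Z]
    {p : Z → EuclideanSpace ℝ (Fin m)} {q : Z → Y} (h : IsProductMetric p q)
    {E : Set (EuclideanSpace ℝ (Fin m))} {F : Set Y} (hE : E.Nonempty) (hF : F.Nonempty) :
    dimH E + dimH F ≤ dimH {z | p z ∈ E ∧ q z ∈ F} := by
  borelize Y Z
  have : Nonempty {s : ℝ≥0 // Measure.hausdorffMeasure s E ≠ 0} :=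
    ⟨0, hausdorffMeasure_zero_ne_zero hE⟩
  have : Nonempty {s : ℝ≥0 // Measure.hausdorffMeasure s F ≠ 0} :=
    ⟨0, hausdorffMeasure_zero_ne_zero hF⟩
  refine (add_le_add (dimH_le_iSup_hausdorffMeasure_ne_zero E)
    (dimH_le_iSup_hausdorffMeasure_ne_zero F)).trans (ENNReal.iSup_add_iSup_le fun s t => ?_)
  rw [← ENNReal.coe_add]
  refine le_dimH_of_hausdorffMeasure_ne_zero ?_
  rw [NNReal.coe_add]
  exact h.hausdorffMeasure_add_ne_zero s.1.coe_nonneg t.1.coe_nonneg s.2 t.2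

/-! ### Products: Hausdorff dimension from above -/

theorem hausdorffMeasure_add_eq_zero {X Y Z : Type*} [MetricSpace X] [MeasurableSpace X]
    [BorelSpace X] [MetricSpace Y] [MetricSpace Z] [MeasurableSpace Z] [BorelSpace Z]
    {p : Z → X} {q : Z → Y} (h : IsProductMetric p q) {E : Set X} {F : Set Y} {s t : ℝ≥0}
    (hs : 0 < s) (hE : Measure.hausdorffMeasure s E = 0) (hF : PackingNumberBound t F) :
    Measure.hausdorffMeasure (s + t : ℝ) {z | p z ∈ E ∧ q z ∈ F} = 0 := by
  by_contra hG
  have hst : (0 : ℝ) ≤ s + t := by positivity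
  obtain ⟨c, hc, hcov⟩ := exists_pos_le_tsum_of_hausdorffMeasure_ne_zero hst hG
  obtain ⟨C, hC⟩ := id hF
  -- A piece `S i` times a ball of radius `r i` has diameter at most `3 * r i`; the added `1` keeps
  -- `K` positive when `C = 0`.
  let K : ℝ≥0 := 3 ^ (s + t : ℝ) * C + 1
  have hK : 0 < K := by positivity
  have hε : ((c / 2 / K : ℝ≥0) : ℝ≥0∞) ≠ 0 := by
    exact_mod_cast (div_pos (half_pos hc) hK).ne'
  obtain ⟨S, r, hES, hr0, hr1, hS, hsum⟩ :=
    exists_cover_of_hausdorffMeasure_eq_zero (by exact_mod_cast hs) hE hε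
  have hN i : packingNumber (r i) F ≠ ⊤ := hF.packingNumber_ne_top (hr0 i) (hr1 i)
  let D : ℕ → Set Y := fun i => maximalSeparatedSet (r i) F
  have hDcard i : (D i).encard = packingNumber (r i) F := encard_maximalSeparatedSet (hN i)
  have hDfin i : Countable (D i) := by
    refine (finite_of_encard_le_coe (k := (packingNumber (r i) F).toNat) ?_).countable.to_subtype
    rw [hDcard, ENat.natCast_toNat (hN i)]
  have h1 := hcov (Σ i, D i) (fun j => {z | p z ∈ S j.1 ∧ q z ∈ closedEBall (j.2 : Y) (r j.1)})
    (fun j => 3 * r j.1) (fun j => ?_) fun z hz => ?_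
  · have h2 : ∑' j : Σ i, D i, ((3 * r j.1 : ℝ≥0) : ℝ≥0∞) ^ (s + t : ℝ) ≤
        K * ((c / 2 / K : ℝ≥0) : ℝ≥0∞) := by
      rw [ENNReal.tsum_sigma']
      refine le_trans ?_ (mul_le_mul_right hsum _)
      rw [← ENNReal.tsum_mul_left]
      refine ENNReal.tsum_le_tsum fun i => ?_
      dsimp only
      rw [ENNReal.tsum_const, ENat.card_coe_set_eq, hDcard, ENNReal.coe_mul,
        ENNReal.mul_rpow_of_nonneg _ _ hst,
        ENNReal.rpow_add_of_nonneg (x := (r i : ℝ≥0∞)) _ _ s.coe_nonneg t.coe_nonneg]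
      calc _ = ((3 : ℝ≥0) : ℝ≥0∞) ^ (s + t : ℝ) *
              ((packingNumber (r i) F : ℝ≥0∞) * (r i : ℝ≥0∞) ^ (t : ℝ)) *
            (r i : ℝ≥0∞) ^ (s : ℝ) := by ring
        _ ≤ ((3 : ℝ≥0) : ℝ≥0∞) ^ (s + t : ℝ) * C * (r i : ℝ≥0∞) ^ (s : ℝ) := by
            gcongr; exact hC _ (hr0 i) (hr1 i)
        _ ≤ _ := by
            gcongr
            rw [← ENNReal.coe_rpow_of_nonneg _ hst, ← ENNReal.coe_mul, ENNReal.coe_le_coe]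
            exact le_self_add
    have h3 := h1.trans h2
    rw [← ENNReal.coe_mul, ENNReal.coe_le_coe, mul_div_cancel₀ _ hK.ne'] at h3
    exact absurd h3 (not_le.2 (half_lt_self hc))
  · calc _ ≤ ediam (S j.1) + ediam (closedEBall (j.2 : Y) (r j.1)) := h.ediam_le _ _
      _ ≤ r j.1 + 2 * r j.1 := add_le_add (hS _) ediam_closedEBall_le
      _ = _ := by push_cast; ring
  · obtain ⟨i, hi⟩ := mem_iUnion.1 (hES hz.1)
    obtain ⟨y, hy, hyz⟩ := isCover_maximalSeparatedSet (hN i) hz.2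
    exact mem_iUnion.2 ⟨⟨i, y, hy⟩, hi, hyz⟩

theorem dimH_le_dimH_add {X Y Z : Type*} [MetricSpace X] [MetricSpace Y] [MetricSpace Z]
    {p : Z → X} {q : Z → Y} (h : IsProductMetric p q) {E : Set X} {F : Set Y} {t : ℝ≥0}
    {T : ℕ → Set Y} (hFT : F ⊆ ⋃ i, T i) (hT : ∀ i, PackingNumberBound t (T i)) :
    dimH {z | p z ∈ E ∧ q z ∈ F} ≤ dimH E + t := by
  borelize X Z
  refine le_add_of_forall_lt_of_forall_lt fun s t' hs ht' => ?_
  refine le_trans ?_ (add_le_add_right ht'.le _)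
  calc dimH {z | p z ∈ E ∧ q z ∈ F} ≤ dimH (⋃ i, {z | p z ∈ E ∧ q z ∈ T i}) := by
        refine dimH_mono fun z hz => ?_
        obtain ⟨i, hi⟩ := mem_iUnion.1 (hFT hz.2)
        exact mem_iUnion.2 ⟨i, hz.1, hi⟩
    _ = ⨆ i, dimH {z | p z ∈ E ∧ q z ∈ T i} := dimH_iUnion _
    _ ≤ ((s + t : ℝ≥0) : ℝ≥0∞) := by
        refine iSup_le fun i => dimH_le_of_hausdorffMeasure_ne_top ?_
        rw [NNReal.coe_add, h.hausdorffMeasure_add_eq_zero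
          (by exact_mod_cast (zero_le.trans_lt hs : (0 : ℝ≥0∞) < s)) (hausdorffMeasure_of_dimH_lt hs) (hT i)]
        exact ENNReal.zero_ne_top
    _ = s + t := ENNReal.coe_add _ _

end IsProductMetric

/-! ### Products: packing dimension from below, by slicing -/

/-- This is the previous estimate with a one-point first factor. -/
theorem dimH_le_of_packingNumberBound {Z : Type*} [MetricSpace Z] {t : ℝ≥0} {A : Set Z}
    {T : ℕ → Set Z} (hA : A ⊆ ⋃ i, T i) (hT : ∀ i, PackingNumberBound t (T i)) : dimH A ≤ t := by
  have h : IsProductMetric (fun _ : Z => ()) (id : Z → Z) :=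
    ⟨fun _ _ => by simp, fun _ _ => le_rfl, fun _ _ => by simp, fun _ z => ⟨z, rfl, rfl⟩⟩
  have := h.dimH_le_dimH_add (E := univ) hA hT
  rw [dimH_subsingleton (s := (univ : Set Unit)) subsingleton_of_subsingleton, zero_add] at this
  simpa using this

theorem packingNumber_mono_set {X : Type*} [MetricSpace X] (r : ℝ≥0) {A B : Set X} (h : A ⊆ B) :
    packingNumber r A ≤ packingNumber r B :=
  iSup_mono fun _ => iSup_mono' fun hC => ⟨hC.trans h, le_rfl⟩

theorem exists_pos_le_packingNumber_mul_of_hausdorffMeasure_ne_zero {X : Type*} [MetricSpace X]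
    [MeasurableSpace X] [BorelSpace X] {s : ℝ} (hs : 0 ≤ s) {A : Set X}
    (h : Measure.hausdorffMeasure s A ≠ 0) :
    ∃ c : ℝ≥0, 0 < c ∧ ∀ r : ℝ≥0, packingNumber r A ≠ ⊤ →
      (c : ℝ≥0∞) ≤ packingNumber r A * (r : ℝ≥0∞) ^ s := by
  obtain ⟨c, hc, hcov⟩ := exists_pos_le_tsum_of_hausdorffMeasure_ne_zero hs h
  have h2 : 0 < (2 : ℝ≥0) ^ s := NNReal.rpow_pos two_pos
  refine ⟨c / 2 ^ s, div_pos hc h2, fun r hN => ?_⟩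
  let D := maximalSeparatedSet r A
  have hDcard : D.encard = packingNumber r A := encard_maximalSeparatedSet hN
  have : Countable D := by
    refine (finite_of_encard_le_coe (k := (packingNumber r A).toNat) ?_).countable.to_subtype
    rw [hDcard, ENat.natCast_toNat hN]
  have h1 := hcov D (fun y => closedEBall (y : X) r) (fun _ => 2 * r)
    (fun y => by push_cast; exact ediam_closedEBall_le) fun x hx => by
      obtain ⟨y, hy, hxy⟩ := isCover_maximalSeparatedSet hN hx
      exact mem_iUnion.2 ⟨⟨y, hy⟩, hxy⟩
  rw [ENNReal.tsum_const, ENat.card_coe_set_eq, hDcard, ENNReal.coe_mul,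
    ENNReal.mul_rpow_of_nonneg _ _ hs, ← ENNReal.coe_rpow_of_nonneg (2 : ℝ≥0) hs] at h1
  rw [ENNReal.coe_div h2.ne']
  refine ENNReal.div_le_of_le_mul (h1.trans_eq ?_)
  ring

theorem exists_finset_cover_card_eq_packingNumber {X : Type*} [MetricSpace X] {A : Set X} {r : ℝ≥0}
    (h : packingNumber r A ≠ ⊤) : ∃ a : Finset X, (a.card : ℕ∞) = packingNumber r A ∧
      ∀ x ∈ A, ∃ y ∈ a, edist x y ≤ r := by
  have hcard := encard_maximalSeparatedSet h
  have hfin : (maximalSeparatedSet r A).Finite := encard_ne_top_iff.1 (by rwa [hcard])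
  refine ⟨hfin.toFinset, by rw [← hcard, hfin.encard_eq_coe_toFinset_card], fun x hx => ?_⟩
  obtain ⟨y, hy, hxy⟩ := isCover_maximalSeparatedSet h hx
  exact ⟨y, hfin.mem_toFinset.2 hy, hxy⟩

namespace IsProductMetric

/-- Over an `r`-separated set of such `y`, the union of maximum `r`-separated subsets of the slices
is `r`-separated in `T`: points over different `y` are apart because `q` does not increase
distances. So the number of `y`, times about `r⁻ˢ`, is `O(r⁻ᵘ)`. -/
theorem packingNumberBound_slices {X Y Z : Type*} [MetricSpace X] [MetricSpace Y] [MetricSpace Z]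
    {p : Z → X} {q : Z → Y} (h : IsProductMetric p q) {T : Set Z} {s u : ℝ≥0} (hsu : s ≤ u)
    (hT : PackingNumberBound u T) (c : ℝ≥0) :
    PackingNumberBound (u - s) {y | ∀ r : ℝ≥0, 0 < r → r ≤ 1 →
      1 ≤ (c : ℝ≥0∞) * ((packingNumber r (T ∩ q ⁻¹' {y}) : ℝ≥0∞) * (r : ℝ≥0∞) ^ (s : ℝ))} := by
  classical
  obtain ⟨C, hC⟩ := id hT
  refine ⟨c * C, fun r hr0 hr1 => packingNumber_mul_le fun D hD hsep => ?_⟩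
  have hN y : packingNumber r (T ∩ q ⁻¹' {y}) ≠ ⊤ := ne_top_of_le_ne_top
    (hT.packingNumber_ne_top hr0 hr1) (packingNumber_mono_set r inter_subset_left)
  choose M hMT hMfin hMsep hMcard using fun y => exists_set_encard_eq_packingNumber (hN y)
  let U := D.biUnion fun y => (hMfin y).toFinset
  have hq {y z} (hz : z ∈ M y) : q z = y := (hMT y hz).2
  have hUcard : U.card = ∑ y ∈ D, (hMfin y).toFinset.card := by
    refine Finset.card_biUnion fun y _ y' _ hne => Finset.disjoint_left.2 fun z hz hz' => hne ?_
    rw [Finite.mem_toFinset] at hz hz'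
    rw [← hq hz, hq hz']
  have hUT : (U.card : ℕ∞) ≤ packingNumber r T := by
    rw [← encard_coe_eq_coe_finsetCard]
    refine IsSeparated.encard_le_packingNumber (fun z hz => ?_) fun z hz w hw hzw => ?_
    · obtain ⟨y, -, hy⟩ := Finset.mem_biUnion.1 hz
      exact (hMT y ((hMfin y).mem_toFinset.1 hy)).1
    · obtain ⟨y, hyD, hy⟩ := Finset.mem_biUnion.1 hz
      obtain ⟨y', hyD', hy'⟩ := Finset.mem_biUnion.1 hw
      rw [Finite.mem_toFinset] at hy hy'
      by_cases hyy : y = y'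
      · subst hyy
        exact hMsep y hy hy' hzw
      · have := hsep hyD hyD' hyy
        rw [← hq hy, ← hq hy'] at this
        exact lt_of_lt_of_le this (h.edist_snd_le z w)
  have hUT' : (U.card : ℝ≥0∞) ≤ packingNumber r T := by exact_mod_cast ENat.toENNReal_le.2 hUT
  calc (D.card : ℝ≥0∞) * (r : ℝ≥0∞) ^ ((u - s : ℝ≥0) : ℝ)
      = ∑ y ∈ D, 1 * (r : ℝ≥0∞) ^ ((u - s : ℝ≥0) : ℝ) := by simp
    _ ≤ ∑ y ∈ D, c * ((hMfin y).toFinset.card * (r : ℝ≥0∞) ^ (s : ℝ)) *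
          (r : ℝ≥0∞) ^ ((u - s : ℝ≥0) : ℝ) := by
        gcongr with y hy
        refine (hD hy r hr0 hr1).trans_eq ?_
        rw [← hMcard, (hMfin y).encard_eq_coe_toFinset_card]
        simp
    _ = c * (U.card * (r : ℝ≥0∞) ^ (u : ℝ)) := by
        have : (r : ℝ≥0∞) ^ (u : ℝ) = (r : ℝ≥0∞) ^ (s : ℝ) * (r : ℝ≥0∞) ^ ((u - s : ℝ≥0) : ℝ) := by
          rw [← ENNReal.rpow_add_of_nonneg _ _ s.coe_nonneg (NNReal.coe_nonneg _),
            ← NNReal.coe_add, add_tsub_cancel_of_le hsu]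
        rw [this, hUcard, Nat.cast_sum, Finset.sum_mul, Finset.mul_sum]
        exact Finset.sum_congr rfl fun y _ => by ring
    _ ≤ c * (packingNumber r T * (r : ℝ≥0∞) ^ (u : ℝ)) := by gcongr
    _ ≤ c * C := by gcongr; exact hC r hr0 hr1
    _ = _ := (ENNReal.coe_mul _ _).symm

theorem dimP_le_sub_of_hausdorffMeasure_ne_zero {X Y Z : Type*} [MetricSpace X]
    [MeasurableSpace X] [BorelSpace X] [MetricSpace Y] [MetricSpace Z] {p : Z → X} {q : Z → Y}
    (h : IsProductMetric p q) {E : Set X} {F : Set Y} {s u : ℝ≥0} (hsu : s ≤ u)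
    (hE : Measure.hausdorffMeasure s E ≠ 0) {T : ℕ → Set Z}
    (hcov : {z | p z ∈ E ∧ q z ∈ F} ⊆ ⋃ i, T i) (hT : ∀ i, PackingNumberBound u (T i)) :
    dimP F ≤ (u - s : ℝ≥0) := by
  borelize Z
  have hp : LipschitzWith 1 p := fun z w => by simpa using h.edist_fst_le z w
  refine dimP_le_of_subset_iUnion (T := fun j : ℕ × ℕ => {y | ∀ r : ℝ≥0, 0 < r → r ≤ 1 →
    1 ≤ ((j.2 : ℝ≥0) : ℝ≥0∞) *
      ((packingNumber r (T j.1 ∩ q ⁻¹' {y}) : ℝ≥0∞) * (r : ℝ≥0∞) ^ (s : ℝ))})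
    (fun y hy => ?_) fun j => h.packingNumberBound_slices hsu (hT j.1) j.2
  -- The slices over `y` project onto a set containing `E` under the 1-Lipschitz map `p`, so they
  -- cannot all be null.
  obtain ⟨i, hi⟩ : ∃ i, Measure.hausdorffMeasure s (T i ∩ q ⁻¹' {y}) ≠ 0 := by
    by_contra! hnull
    refine hE (measure_mono_null (t := ⋃ i, p '' (T i ∩ q ⁻¹' {y})) (fun x hx => ?_)
      (measure_iUnion_null fun i => ?_))
    · obtain ⟨z, rfl, rfl⟩ := h.exists_eq x y
      obtain ⟨i, hi⟩ := mem_iUnion.1 (hcov ⟨hx, hy⟩)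
      exact mem_iUnion.2 ⟨i, z, ⟨hi, rfl⟩, rfl⟩
    · have := hp.hausdorffMeasure_image_le s.coe_nonneg (T i ∩ q ⁻¹' {y})
      rw [hnull, mul_zero] at this
      exact le_antisymm this bot_le
  obtain ⟨c, hc, hle⟩ :=
    exists_pos_le_packingNumber_mul_of_hausdorffMeasure_ne_zero s.coe_nonneg hi
  -- The constant `c` depends on `y`; integer bounds on its inverse leave countably many classes.
  obtain ⟨k, hk⟩ := exists_nat_ge c⁻¹
  refine mem_iUnion.2 ⟨(i, k), fun r hr0 hr1 => ?_⟩
  have h1 : (1 : ℝ≥0) ≤ k * c := by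
    rw [← inv_mul_cancel₀ hc.ne']
    gcongr
  calc (1 : ℝ≥0∞) ≤ ((k : ℝ≥0) : ℝ≥0∞) * c := by exact_mod_cast h1
    _ ≤ _ := by
        gcongr
        exact hle r (ne_top_of_le_ne_top ((hT i).packingNumber_ne_top hr0 hr1)
          (packingNumber_mono_set r inter_subset_left))

theorem dimH_add_dimP_le {X Y Z : Type*} [MetricSpace X] [MetricSpace Y] [MetricSpace Z]
    {p : Z → X} {q : Z → Y} (h : IsProductMetric p q) {E : Set X} {F : Set Y} (hE : E.Nonempty)
    (hF : F.Nonempty) {u : ℝ≥0} {T : ℕ → Set Z} (hcov : {z | p z ∈ E ∧ q z ∈ F} ⊆ ⋃ i, T i)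
    (hT : ∀ i, PackingNumberBound u (T i)) : dimH E + dimP F ≤ u := by
  borelize X
  have : Nonempty {s : ℝ≥0 // Measure.hausdorffMeasure s E ≠ 0} :=
    ⟨0, hausdorffMeasure_zero_ne_zero hE⟩
  have hp : LipschitzWith 1 p := fun z w => by simpa using h.edist_fst_le z w
  -- This ensures `s ≤ u` for the relevant `s`, so that the truncated difference `u - s` is a true
  -- one.
  have hEu : dimH E ≤ u := by
    obtain ⟨y, hy⟩ := hF
    calc dimH E ≤ dimH (p '' {z | p z ∈ E ∧ q z ∈ F}) := by
          refine dimH_mono fun x hx => ?_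
          obtain ⟨z, rfl, rfl⟩ := h.exists_eq x y
          exact ⟨z, ⟨hx, hy⟩, rfl⟩
      _ ≤ dimH {z | p z ∈ E ∧ q z ∈ F} := hp.dimH_image_le _
      _ ≤ u := dimH_le_of_packingNumberBound hcov hT
  refine (add_le_add_left (dimH_le_iSup_hausdorffMeasure_ne_zero E) _).trans ?_
  rw [ENNReal.iSup_add]
  refine iSup_le fun s => ?_
  have hsu : (s : ℝ≥0) ≤ u := by
    exact_mod_cast (le_dimH_of_hausdorffMeasure_ne_zero s.2).trans hEu
  calc ((s : ℝ≥0) : ℝ≥0∞) + dimP F ≤ (s : ℝ≥0) + (u - s : ℝ≥0) :=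
        add_le_add_right (h.dimP_le_sub_of_hausdorffMeasure_ne_zero hsu s.2 hcov hT) _
    _ = u := by rw [← ENNReal.coe_add, add_tsub_cancel_of_le hsu]

/-! ### Products: packing dimension from above -/

theorem packingNumberBound_prod {X Y Z : Type*} [MetricSpace X] [MetricSpace Y] [MetricSpace Z]
    {p : Z → X} {q : Z → Y} (h : IsProductMetric p q) {A : Set X} {B : Set Y} {s t : ℝ≥0}
    (hA : PackingNumberBound s A) (hB : PackingNumberBound t B) :
    PackingNumberBound (s + t) {z | p z ∈ A ∧ q z ∈ B} := by
  obtain ⟨C₁, hC₁⟩ := id hA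
  obtain ⟨C₂, hC₂⟩ := id hB
  have hst : (0 : ℝ) ≤ s + t := by positivity
  refine ⟨4 ^ (s + t : ℝ) * (C₁ * C₂), fun r hr0 hr1 => packingNumber_mul_le fun D hD hsep => ?_⟩
  -- Two points assigned to the same pair of `ρ`-balls are within `2ρ + 2ρ`, so a `4ρ`-separated set
  -- injects into the pairs.
  obtain ⟨ρ, rfl⟩ : ∃ ρ, r = 4 * ρ := ⟨r / 4, (mul_div_cancel₀ r four_ne_zero).symm⟩
  have hρ0 : 0 < ρ := pos_of_mul_pos_right hr0 bot_le
  have hρ1 : ρ ≤ 1 := le_trans (le_mul_of_one_le_left bot_le (by norm_num)) hr1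
  have hNA := hA.packingNumber_ne_top hρ0 hρ1
  have hNB := hB.packingNumber_ne_top hρ0 hρ1
  obtain ⟨a, ha, haA⟩ := exists_finset_cover_card_eq_packingNumber hNA
  obtain ⟨b, hb, hbB⟩ := exists_finset_cover_card_eq_packingNumber hNB
  choose! f hfa hf using haA
  choose! g hgb hg using hbB
  have hcard : D.card ≤ a.card * b.card := by
    rw [← Finset.card_product]
    refine Finset.card_le_card_of_injOn (fun z => (f (p z), g (q z))) (fun z hz => ?_)
      fun z hz w hw hzw => ?_
    · exact Finset.mem_coe.2 (Finset.mem_product.2 ⟨hfa _ (hD hz).1, hgb _ (hD hz).2⟩)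
    · by_contra hne
      have hsepzw : ((4 * ρ : ℝ≥0) : ℝ≥0∞) < edist z w := hsep hz hw hne
      obtain ⟨h1, h2⟩ := Prod.ext_iff.1 hzw
      dsimp only at h1 h2
      refine absurd hsepzw (not_lt.2 ?_)
      calc edist z w ≤ edist (p z) (p w) + edist (q z) (q w) := h.edist_le z w
        _ ≤ (edist (p z) (f (p z)) + edist (p w) (f (p z))) +
              (edist (q z) (g (q z)) + edist (q w) (g (q z))) :=
            add_le_add (edist_triangle_right _ _ _) (edist_triangle_right _ _ _)
        _ ≤ (ρ + ρ) + (ρ + ρ) := by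
            refine add_le_add (add_le_add (hf _ (hD hz).1) ?_) (add_le_add (hg _ (hD hz).2) ?_)
            · rw [h1]; exact hf _ (hD hw).1
            · rw [h2]; exact hg _ (hD hw).2
        _ = ((4 * ρ : ℝ≥0) : ℝ≥0∞) := by push_cast; ring
  have ha' : (a.card : ℝ≥0∞) = packingNumber ρ A := by rw [← ha]; simp
  have hb' : (b.card : ℝ≥0∞) = packingNumber ρ B := by rw [← hb]; simp
  have hcard' : (D.card : ℝ≥0∞) ≤ a.card * b.card := by exact_mod_cast hcard
  rw [NNReal.coe_add, ENNReal.coe_mul, ENNReal.mul_rpow_of_nonneg _ _ hst,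
    ENNReal.rpow_add_of_nonneg (x := (ρ : ℝ≥0∞)) _ _ s.coe_nonneg t.coe_nonneg]
  calc (D.card : ℝ≥0∞) * (((4 : ℝ≥0) : ℝ≥0∞) ^ (s + t : ℝ) *
        ((ρ : ℝ≥0∞) ^ (s : ℝ) * (ρ : ℝ≥0∞) ^ (t : ℝ)))
      ≤ (a.card * b.card) * (((4 : ℝ≥0) : ℝ≥0∞) ^ (s + t : ℝ) *
        ((ρ : ℝ≥0∞) ^ (s : ℝ) * (ρ : ℝ≥0∞) ^ (t : ℝ))) := by gcongr
    _ = ((4 : ℝ≥0) : ℝ≥0∞) ^ (s + t : ℝ) * ((packingNumber ρ A * (ρ : ℝ≥0∞) ^ (s : ℝ)) *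
        (packingNumber ρ B * (ρ : ℝ≥0∞) ^ (t : ℝ))) := by rw [ha', hb']; ring
    _ ≤ ((4 : ℝ≥0) : ℝ≥0∞) ^ (s + t : ℝ) * (C₁ * C₂) := by
        gcongr
        · exact hC₁ ρ hρ0 hρ1
        · exact hC₂ ρ hρ0 hρ1
    _ = _ := by rw [ENNReal.coe_mul, ENNReal.coe_mul, ENNReal.coe_rpow_of_nonneg _ hst]

theorem dimP_le_add {X Y Z : Type*} [MetricSpace X] [MetricSpace Y] [MetricSpace Z]
    {p : Z → X} {q : Z → Y} (h : IsProductMetric p q) {E : Set X} {F : Set Y} {s t : ℝ≥0}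
    {S : ℕ → Set X} {T : ℕ → Set Y} (hE : E ⊆ ⋃ i, S i) (hF : F ⊆ ⋃ i, T i)
    (hS : ∀ i, PackingNumberBound s (S i)) (hT : ∀ i, PackingNumberBound t (T i)) :
    dimP {z | p z ∈ E ∧ q z ∈ F} ≤ s + t := by
  rw [← ENNReal.coe_add]
  refine dimP_le_of_subset_iUnion (T := fun j : ℕ × ℕ => {z | p z ∈ S j.1 ∧ q z ∈ T j.2})
    (fun z hz => ?_) fun j => h.packingNumberBound_prod (hS j.1) (hT j.2)
  obtain ⟨i, hi⟩ := mem_iUnion.1 (hE hz.1)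
  obtain ⟨j, hj⟩ := mem_iUnion.1 (hF hz.2)
  exact mem_iUnion.2 ⟨(i, j), hi, hj⟩

end IsProductMetric

/-! ### The Euclidean product and the theorem -/

theorem isProductMetric_euclideanSpace (m n : ℕ) : IsProductMetric
    (fun z : EuclideanSpace ℝ (Fin (m + n)) =>
      (WithLp.toLp 2 fun i : Fin m => z (Fin.castAdd n i) : EuclideanSpace ℝ (Fin m)))
    (fun z => (WithLp.toLp 2 fun j : Fin n => z (Fin.natAdd m j) : EuclideanSpace ℝ (Fin n))) := by
  have hle {a b : ℝ} (ha : 0 ≤ a) (hb : 0 ≤ b) : √(a + b) ≤ √a + √b :=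
    Real.sqrt_le_iff.2 ⟨by positivity, by
      nlinarith [Real.sq_sqrt ha, Real.sq_sqrt hb, Real.sqrt_nonneg a, Real.sqrt_nonneg b,
        mul_nonneg (Real.sqrt_nonneg a) (Real.sqrt_nonneg b)]⟩
  refine ⟨fun z w => ?_, fun z w => ?_, fun z w => ?_, fun x y => ?_⟩
  · rw [edist_dist, edist_dist]
    refine ENNReal.ofReal_le_ofReal ?_
    rw [EuclideanSpace.dist_eq, EuclideanSpace.dist_eq, Fin.sum_univ_add]
    exact Real.sqrt_le_sqrt (le_add_of_nonneg_right (by positivity))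
  · rw [edist_dist, edist_dist]
    refine ENNReal.ofReal_le_ofReal ?_
    rw [EuclideanSpace.dist_eq, EuclideanSpace.dist_eq, Fin.sum_univ_add]
    exact Real.sqrt_le_sqrt (le_add_of_nonneg_left (by positivity))
  · rw [edist_dist, edist_dist, edist_dist, ← ENNReal.ofReal_add dist_nonneg dist_nonneg]
    refine ENNReal.ofReal_le_ofReal ?_
    rw [EuclideanSpace.dist_eq, EuclideanSpace.dist_eq, EuclideanSpace.dist_eq, Fin.sum_univ_add]
    exact hle (by positivity) (by positivity)
  · refine ⟨WithLp.toLp 2 (Fin.append x y), ?_, ?_⟩ <;> ext i <;> simp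

theorem theorem5p1 (m n : ℕ) (E : Set (EuclideanSpace ℝ (Fin m)))
    (F : Set (EuclideanSpace ℝ (Fin n))) (hE : E.Nonempty) (hF : F.Nonempty) :
    dimH E + dimH F ≤ dimH (euclideanProd E F) ∧
    dimH (euclideanProd E F) ≤ dimH E + dimP F ∧
    dimH E + dimP F ≤ dimP (euclideanProd E F) ∧
    dimP (euclideanProd E F) ≤ dimP E + dimP F := by
  have h := isProductMetric_euclideanSpace m n
  refine ⟨h.dimH_add_dimH_le hE hF, ?_, ?_, ?_⟩
  · refine le_add_of_forall_lt_of_forall_lt fun s t hs ht => ?_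
    obtain ⟨T, hcov, hT⟩ := exists_cover_packingNumberBound_of_dimP_lt ht
    exact (h.dimH_le_dimH_add hcov hT).trans (add_le_add_left hs.le _)
  · refine le_of_forall_gt_imp_ge_of_dense fun u hu => ?_
    rcases eq_or_ne u ∞ with rfl | hu'
    · exact le_top
    lift u to ℝ≥0 using hu'
    obtain ⟨T, hcov, hT⟩ := exists_cover_packingNumberBound_of_dimP_lt hu
    exact h.dimH_add_dimP_le hE hF hcov hT
  · refine le_add_of_forall_lt_of_forall_lt fun s t hs ht => ?_
    obtain ⟨S, hS, hSb⟩ := exists_cover_packingNumberBound_of_dimP_lt hs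
    obtain ⟨T, hT, hTb⟩ := exists_cover_packingNumberBound_of_dimP_lt ht
    exact h.dimP_le_add hS hT hSb hTb
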